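/- Let $G$ be a matrix Lie group, i.e. a closed subgroup of $GL(n,\mathbb R)$, with Lie algebra $\mathfrak g=\{x\in\mathbb R^{n\times n}: \exp(tx)\in G \text{ for all } t\in\mathbb R\}$ of dimension $d$. Fix a linear isomorphism $(\cdot)^\wedge:\mathbb R^d\to\mathfrak g$ with inverse $(\cdot)^\vee$, and put $\exp_{\rm m}(x)=\exp(x^\wedge)\in G$. For $x\in\mathbb R^d$ let $\mathrm{adm}_x$ be the $d\times d$ matrix with $\mathrm{adm}_x y=(x^\wedge y^\wedge-y^\wedge x^\wedge)^\vee$ and let $\mathrm{dexp_m}(x)=\sum_{i\ge 0}\frac{1}{(i+1)!}\mathrm{adm}_x^{\,i}$; for $X\in G$ and $w\in\mathbb R^d$ write $\mathrm{Ad}_X w=(Xw^\wedge X^{-1})^\vee$. Let $\log_{\rm m}$ be a Lie logarithm, that is, a continuous inverse of $\exp_{\rm m}$ on a neighbourhood $D\subseteq G$ of the identity: $\exp_{\rm m}(\log_{\rm m}X)=X$ for $X\in D$, and $\log_{\rm m}(\exp_{\rm m}x)=x$ for $x$ near $0$. Let $\mathcal U$ be a set of inputs and, for each $u\in\mathcal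 U$, let $f_u$ be a vector field on $G$ (so $X^{-1}f_u(X)\in\mathfrak g$ for $X\in G$) with the affine group property $$f_u(XY)=f_u(X)Y+Xf_u(Y)-Xf_u(I)Y,\qquad X,Y\in G,$$ such that $x\mapsto(\exp_{\rm m}(x)^{-1}f_u(\exp_{\rm m}(x)))^\vee$ is differentiable at $x=0$. Let $t_0\in\mathbb R$, $T\in(t_0,\infty]$, let $u_t\in\mathcal U$ be an input, let $w_t\in\mathbb R^d$ be a smooth disturbance on $[t_0,T)$, and let $X_t,\hat X_t\in G$ satisfy on $[t_0,T)$ $$\dot X_t=f_{u_t}(X_t)+X_tw_t^\wedge,\qquad \dot{\hat X}_t=f_{u_t}(\hat X_t).$$ Put $\eta^{\rm L}_t=\hat X_t^{-1}X_t$ and $\eta^{\rm R}_t=X_t\hat X_t^{-1}$. Let $A^{\rm L}_t$ and $A^{\rm R}_t$ be the differentials at $x=0$ of $x\mapsto(\exp_{\rm m}(x)^{-1}g_t(\exp_{\rm m}(x)))^\vee$ for, respectively, $g_t(\eta)=f_{u_t}(\eta)-f_{u_t}(I)\eta$ and $g_t(\eta)=f_{u_t}(\eta)-\eta f_{u_t}(I)$,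 the vector fields that govern the two errors when $w=0$. (LIE) If $\eta^{\rm L}_t\in D$ for all $t\in[t_0,T)$ and, with $\xi^{\rm L}_t=\log_{\rm m}(\eta^{\rm L}_t)$, the matrix $\mathrm{dexp_m}(-\xi^{\rm L}_t)$ is invertible for all $t\in[t_0,T)$, then $\xi^{\rm L}$ is differentiable on $[t_0,T)$ and $$\dot\xi^{\rm L}_t=\mathrm{dexp_m}(-\xi^{\rm L}_t)^{-1}w_t+A^{\rm L}_t\xi^{\rm L}_t .$$ (RIE) If $\eta^{\rm R}_t\in D$ for all $t\in[t_0,T)$ and, with $\xi^{\rm R}_t=\log_{\rm m}(\eta^{\rm R}_t)$, the matrix $\mathrm{dexp_m}(-\xi^{\rm R}_t)$ is invertible for all $t\in[t_0,T)$, then $\xi^{\rm R}$ is differentiable on $[t_0,T)$ and $$\dot\xi^{\rm R}_t=\mathrm{dexp_m}(-\xi^{\rm R}_t)^{-1}\,\mathrm{Ad}_{\hat X_t}w_t+A^{\rm R}_t\xi^{\rm R}_t .$$ At $t_0$ all derivatives are one-sided. -/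

import Mathlib

open scoped Matrix ContDiff Topology

noncomputable section

namespace MatrixLie

variable {n d : ℕ}

section Helpers

open Filter NormedSpace

open scoped Matrix.Norms.Operator

/-- If `γ 0 = 1` and `γ' (0) = z` then `γ (1 / k) ^ k → exp z`. -/
theorem tendsto_pow_exp {γ : ℝ → Matrix (Fin n) (Fin n) ℝ} {z : Matrix (Fin n) (Fin n) ℝ}
    (h0 : γ 0 = 1) (hγ : HasDerivAt γ z 0) :
    Tendsto (fun k : ℕ => γ ((k : ℝ)⁻¹) ^ k) atTop (𝓝 (exp z)) := by
  have hexp : HasStrictFDerivAt (exp : Matrix (Fin n) (Fin n) ℝ → Matrix (Fin n) (Fin n) ℝ)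
      ((ContinuousLinearEquiv.refl ℝ (Matrix (Fin n) (Fin n) ℝ) :
        Matrix (Fin n) (Fin n) ℝ ≃L[ℝ] Matrix (Fin n) (Fin n) ℝ) :
        Matrix (Fin n) (Fin n) ℝ →L[ℝ] Matrix (Fin n) (Fin n) ℝ) 0 :=
    hasStrictFDerivAt_exp_zero
  set lg := hexp.localInverse exp _ 0 with hlg
  have hlgd : HasFDerivAt lg _ (exp (0 : Matrix (Fin n) (Fin n) ℝ)) :=
    hexp.to_localInverse.hasFDerivAt
  have hlg0 : lg (exp (0 : Matrix (Fin n) (Fin n) ℝ)) = 0 := hexp.localInverse_apply_image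
  have hright : ∀ᶠ y in 𝓝 (exp (0 : Matrix (Fin n) (Fin n) ℝ)), exp (lg y) = y :=
    hexp.eventually_right_inverse
  rw [exp_zero] at hlgd hlg0 hright
  rw [← h0] at hlgd
  have hc : HasDerivAt (lg ∘ γ) z 0 := by
    exact hlgd.comp_hasDerivAt (0 : ℝ) hγ
  have hk0 : Tendsto (fun k : ℕ => ((k : ℝ)⁻¹)) atTop (𝓝 0) :=
    tendsto_inv_atTop_nhds_zero_nat
  have hk : Tendsto (fun k : ℕ => ((k : ℝ)⁻¹)) atTop (𝓝[≠] 0) := by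
    refine tendsto_nhdsWithin_iff.2 ⟨hk0, ?_⟩
    filter_upwards [eventually_gt_atTop 0] with k hk
    simp [hk.ne']
  have hs : Tendsto (fun k : ℕ => (k : ℝ) • lg (γ ((k : ℝ)⁻¹))) atTop (𝓝 z) := by
    have := (hasDerivAt_iff_tendsto_slope.1 hc).comp hk
    refine this.congr fun k => ?_
    simp [slope, h0, hlg0]
  have hr : ∀ᶠ k : ℕ in atTop, exp (lg (γ ((k : ℝ)⁻¹))) = γ ((k : ℝ)⁻¹) := by
    have h1 : Tendsto (fun k : ℕ => γ ((k : ℝ)⁻¹)) atTop (𝓝 1) := by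
      rw [← h0]; exact hγ.continuousAt.tendsto.comp hk0
    exact h1.eventually hright
  have he : Tendsto (fun k : ℕ => exp ((k : ℝ) • lg (γ ((k : ℝ)⁻¹)))) atTop (𝓝 (exp z)) :=
    (exp_continuous.tendsto z).comp hs
  refine he.congr' ?_
  filter_upwards [hr] with k hk
  rw [Nat.cast_smul_eq_nsmul, Matrix.exp_nsmul, hk]

/-- A limit of elements of `G` that is an invertible matrix lies in `G`. -/
theorem exists_mem_of_tendsto (G : ClosedSubgroup (GL (Fin n) ℝ))
    {M : ℕ → Matrix (Fin n) (Fin n) ℝ} {L : Matrix (Fin n) (Fin n) ℝ}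
    (hM : ∀ k, ∃ g ∈ G, (g : Matrix (Fin n) (Fin n) ℝ) = M k) (hL : IsUnit L)
    (h : Tendsto M atTop (𝓝 L)) : ∃ g ∈ G, (g : Matrix (Fin n) (Fin n) ℝ) = L := by
  choose g hg hgM using hM
  obtain ⟨l, rfl⟩ := hL
  refine ⟨l, ?_, rfl⟩
  have hl : Tendsto g atTop (𝓝 l) := by
    have he := (Units.isOpenEmbedding_val (R := Matrix (Fin n) (Fin n) ℝ)).isEmbedding
    refine he.tendsto_nhds_iff.2 ?_
    have hM' : (Units.val ∘ g : ℕ → Matrix (Fin n) (Fin n) ℝ) = M := funext hgM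
    exact hM' ▸ h
  exact G.isClosed'.mem_of_tendsto hl (Eventually.of_forall hg)

/-- A differentiable curve of elements of `G` through `1` has its velocity in the Lie algebra. -/
theorem exp_mem_of_curve (G : ClosedSubgroup (GL (Fin n) ℝ))
    {γ : ℝ → Matrix (Fin n) (Fin n) ℝ} {z : Matrix (Fin n) (Fin n) ℝ}
    (hG : ∀ s, ∃ g ∈ G, (g : Matrix (Fin n) (Fin n) ℝ) = γ s)
    (h0 : γ 0 = 1) (hγ : HasDerivAt γ z 0) (t : ℝ) :
    ∃ g ∈ G, (g : Matrix (Fin n) (Fin n) ℝ) = exp (t • z) := by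
  have h1 : HasDerivAt (fun s => γ (t * s)) (t • z) 0 := by
    have h2 : HasDerivAt (fun s : ℝ => t * s) t 0 := by
      simpa using (hasDerivAt_id (0 : ℝ)).const_mul t
    have h3 : HasDerivAt γ z (t * 0) := by simpa using hγ
    exact h3.scomp (0 : ℝ) h2
  refine exists_mem_of_tendsto G (fun k => ?_) (Matrix.isUnit_exp _)
    (tendsto_pow_exp (γ := fun s => γ (t * s)) (by simpa using h0) h1)
  obtain ⟨g, hg, hgγ⟩ := hG (t * (k : ℝ)⁻¹)
  exact ⟨g ^ k, pow_mem hg k, by simp [hgγ]⟩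

theorem hasDerivAt_exp_smul_zero (x : Matrix (Fin n) (Fin n) ℝ) :
    HasDerivAt (fun s : ℝ => exp (s • x)) x 0 := by
  have h := hasDerivAt_exp_smul_const (𝕂 := ℝ) x (0 : ℝ)
  rw [zero_smul, exp_zero, one_mul] at h
  exact h

theorem exp_add_mem (G : ClosedSubgroup (GL (Fin n) ℝ)) {x y : Matrix (Fin n) (Fin n) ℝ}
    (hx : ∀ t : ℝ, ∃ g ∈ G, (g : Matrix (Fin n) (Fin n) ℝ) = exp (t • x))
    (hy : ∀ t : ℝ, ∃ g ∈ G, (g : Matrix (Fin n) (Fin n) ℝ) = exp (t • y)) (t : ℝ) :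
    ∃ g ∈ G, (g : Matrix (Fin n) (Fin n) ℝ) = exp (t • (x + y)) := by
  refine exp_mem_of_curve G (γ := fun s => exp (s • x) * exp (s • y)) (fun s => ?_) (by simp) ?_ t
  · obtain ⟨g, hg, hgx⟩ := hx s
    obtain ⟨k, hk, hky⟩ := hy s
    exact ⟨g * k, mul_mem hg hk, by simp [hgx, hky]⟩
  · have h := (hasDerivAt_exp_smul_zero x).mul (hasDerivAt_exp_smul_zero y)
    rw [zero_smul, zero_smul, exp_zero, one_mul, mul_one] at h
    exact h

theorem exp_conj_mem (G : ClosedSubgroup (GL (Fin n) ℝ)) {x : Matrix (Fin n) (Fin n) ℝ}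
    (hx : ∀ t : ℝ, ∃ g ∈ G, (g : Matrix (Fin n) (Fin n) ℝ) = exp (t • x))
    {X : GL (Fin n) ℝ} (hX : X ∈ G) (t : ℝ) :
    ∃ g ∈ G, (g : Matrix (Fin n) (Fin n) ℝ) =
      exp (t • ((X : Matrix (Fin n) (Fin n) ℝ) * x *
        ((X⁻¹ : GL (Fin n) ℝ) : Matrix (Fin n) (Fin n) ℝ))) := by
  obtain ⟨g, hg, hgx⟩ := hx t
  refine ⟨X * g * X⁻¹, mul_mem (mul_mem hX hg) (inv_mem hX), ?_⟩
  have := Matrix.exp_units_conj X (t • x)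
  rw [Units.val_mul, Units.val_mul, hgx, ← this]
  simp

/-- The Lie algebra `𝔤 = {x | exp (t x) ∈ G for all t ∈ ℝ}` of a matrix Lie group, i.e. of a closed
subgroup `G` of `GL(n, ℝ)`. -/
def lieAlgebra (G : ClosedSubgroup (GL (Fin n) ℝ)) :
    Submodule ℝ (Matrix (Fin n) (Fin n) ℝ) where
  carrier := {x | ∀ t : ℝ, ∃ g ∈ G, (g : Matrix (Fin n) (Fin n) ℝ) = exp (t • x)}
  add_mem' hx hy := exp_add_mem G hx hy
  zero_mem' _ := ⟨1, one_mem G, by simp⟩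
  smul_mem' c x hx t := by simpa [smul_smul] using hx (t * c)

theorem lie_mem (G : ClosedSubgroup (GL (Fin n) ℝ)) {x y : Matrix (Fin n) (Fin n) ℝ}
    (hx : x ∈ lieAlgebra G) (hy : y ∈ lieAlgebra G) : x * y - y * x ∈ lieAlgebra G := by
  have hd : HasDerivAt (fun s : ℝ => exp (s • x) * y * exp (s • (-x))) (x * y - y * x) 0 := by
    have := ((hasDerivAt_exp_smul_zero x).mul_const y).mul (hasDerivAt_exp_smul_zero (-x))
    rw [zero_smul, zero_smul, exp_zero, one_mul, mul_one, mul_neg, ← sub_eq_add_neg] at this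
    exact this
  have hm : ∀ s : ℝ, exp (s • x) * y * exp (s • (-x)) ∈ lieAlgebra G := by
    intro s
    obtain ⟨g, hg, hgx⟩ := hx s
    have : exp (s • (-x)) = ((g⁻¹ : GL (Fin n) ℝ) : Matrix (Fin n) (Fin n) ℝ) := by
      rw [smul_neg, Matrix.exp_neg, ← hgx, Matrix.coe_units_inv]
    rw [this, ← hgx]
    exact exp_conj_mem G hy hg
  have hcl : IsClosed (lieAlgebra G : Set (Matrix (Fin n) (Fin n) ℝ)) :=
    Submodule.closed_of_finiteDimensional _
  refine hcl.mem_of_tendsto (hasDerivAt_iff_tendsto_slope.1 hd) (Eventually.of_forall fun s => ?_)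
  exact (lieAlgebra G).smul_mem _ ((lieAlgebra G).sub_mem (hm s) (hm 0))

end Helpers

variable {G : ClosedSubgroup (GL (Fin n) ℝ)}

/-- The matrix underlying an element of the group. -/
abbrev mat (X : G) : Matrix (Fin n) (Fin n) ℝ := ((X : GL (Fin n) ℝ) : Matrix (Fin n) (Fin n) ℝ)

theorem exp_unit_mem (x : lieAlgebra G) :
    (Matrix.isUnit_exp (x : Matrix (Fin n) (Fin n) ℝ)).unit ∈ G := by
  obtain ⟨g, hg, h⟩ := x.2 1
  have : (Matrix.isUnit_exp (x : Matrix (Fin n) (Fin n) ℝ)).unit = g := by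
    apply Units.ext
    rw [IsUnit.unit_spec, h, one_smul]
  rwa [this]

/-- The matrix exponential as a map from the Lie algebra to the group. -/
def expG (x : lieAlgebra G) : G :=
  ⟨(Matrix.isUnit_exp (x : Matrix (Fin n) (Fin n) ℝ)).unit, exp_unit_mem x⟩

/-- The Lie exponential `exp_m : ℝᵈ → G`, for an identification `hat` of `ℝᵈ` with `𝔤`. -/
def expm (hat : (Fin d → ℝ) ≃ₗ[ℝ] lieAlgebra G) (x : Fin d → ℝ) : G := expG (hat x)

/-- `log` is a Lie logarithm on `D`: `D` is a neighbourhood of the identity of `G`, and on `D` the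
map `log` is a continuous inverse of `exp_m`, with `log (exp_m x) = x` for all `x` near `0`. -/
structure IsLieLog (hat : (Fin d → ℝ) ≃ₗ[ℝ] lieAlgebra G) (D : Set G) (log : G → Fin d → ℝ) :
    Prop where
  mem_nhds : D ∈ 𝓝 (1 : G)
  continuousOn : ContinuousOn log D
  exp_log : ∀ X ∈ D, expm hat (log X) = X
  log_exp : ∀ᶠ x in 𝓝 (0 : Fin d → ℝ), log (expm hat x) = x

/-- The adjoint action `Ad_X y = X y X⁻¹` of `G` on `𝔤`. -/
def Ad (X : G) (y : lieAlgebra G) : lieAlgebra G :=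
  ⟨mat X * (y : Matrix (Fin n) (Fin n) ℝ) * mat X⁻¹, exp_conj_mem G y.2 X.2⟩

/-- The adjoint action of `G` on `ℝᵈ`, i.e. `w ↦ (Ad_X w^∧)^∨`. -/
def Adm (hat : (Fin d → ℝ) ≃ₗ[ℝ] lieAlgebra G) (X : G) (w : Fin d → ℝ) : Fin d → ℝ :=
  hat.symm (Ad X (hat w))

/-- `ad_x y = [x, y] = x y - y x` on `𝔤`. -/
def ad (x : lieAlgebra G) : lieAlgebra G →ₗ[ℝ] lieAlgebra G where
  toFun y := ⟨(x : Matrix (Fin n) (Fin n) ℝ) * y - y * x, lie_mem G x.2 y.2⟩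
  map_add' y z := by ext1; simp only [Submodule.coe_add]; noncomm_ring
  map_smul' c y := by ext1; simp [smul_sub]

/-- The matrix of `ad_{x^∧} = [x^∧, ·]` under the identification `hat`. -/
def adm (hat : (Fin d → ℝ) ≃ₗ[ℝ] lieAlgebra G) (x : Fin d → ℝ) : Matrix (Fin d) (Fin d) ℝ :=
  LinearMap.toMatrix' (hat.symm.toLinearMap ∘ₗ ad (hat x) ∘ₗ hat.toLinearMap)

/-- `dexp_m(x) = ∑ adm_x ^ i / (i + 1)!`. -/
def dexpm (hat : (Fin d → ℝ) ≃ₗ[ℝ] lieAlgebra G) (x : Fin d → ℝ) : Matrix (Fin d) (Fin d) ℝ :=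
  ∑' i : ℕ, ((i + 1).factorial : ℝ)⁻¹ • adm hat x ^ i

open Classical in
/-- The inverse `M ↦ M^∨` of `hat`, extended by `0` to matrices outside `𝔤`. -/
def vee (hat : (Fin d → ℝ) ≃ₗ[ℝ] lieAlgebra G) (M : Matrix (Fin n) (Fin n) ℝ) : Fin d → ℝ :=
  if h : M ∈ lieAlgebra G then hat.symm ⟨M, h⟩ else 0

/-- `F` is a vector field on `G`: `F X` lies in the tangent space `T_X G = X 𝔤`. -/
def IsVectorField (F : G → Matrix (Fin n) (Fin n) ℝ) : Prop :=
  ∀ X : G, mat X⁻¹ * F X ∈ lieAlgebra G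

/-- `F (X Y) = F X Y + X F Y - X F(I) Y`. -/
def IsGroupAffine (F : G → Matrix (Fin n) (Fin n) ℝ) : Prop :=
  ∀ X Y : G, F (X * Y) = F X * mat Y + mat X * F Y - mat X * F 1 * mat Y

/-- A vector field in exponential coordinates: `x ↦ (exp_m(x)⁻¹ F(exp_m(x)))^∨`. -/
def pullback (hat : (Fin d → ℝ) ≃ₗ[ℝ] lieAlgebra G) (F : G → Matrix (Fin n) (Fin n) ℝ)
    (x : Fin d → ℝ) : Fin d → ℝ :=
  vee hat (mat (expm hat x)⁻¹ * F (expm hat x))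

/-- The differential at `x = 0` of `x ↦ (exp_m(x)⁻¹ F(exp_m(x)))^∨`. -/
def linearization (hat : (Fin d → ℝ) ≃ₗ[ℝ] lieAlgebra G) (F : G → Matrix (Fin n) (Fin n) ℝ) :
    (Fin d → ℝ) →L[ℝ] (Fin d → ℝ) :=
  fderiv ℝ (pullback hat F) 0

/-- The vector field of the disturbance-free left invariant error: `η ↦ F η - F(I) η`. -/
def leftErrorField (F : G → Matrix (Fin n) (Fin n) ℝ) (X : G) : Matrix (Fin n) (Fin n) ℝ :=
  F X - F 1 * mat X

/-- The vector field of the disturbance-free right invariant error: `η ↦ F η - η F(I)`. -/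
def rightErrorField (F : G → Matrix (Fin n) (Fin n) ℝ) (X : G) : Matrix (Fin n) (Fin n) ℝ :=
  F X - mat X * F 1

/-- The left invariant error `X̂⁻¹ X`. -/
def leftError (X Xhat : ℝ → G) (t : ℝ) : G := (Xhat t)⁻¹ * X t

/-- The right invariant error `X X̂⁻¹`. -/
def rightError (X Xhat : ℝ → G) (t : ℝ) : G := X t * (Xhat t)⁻¹

/-- The interval `[t₀, T)` with `T ∈ (t₀, ∞]`. -/
def timeInterval (t₀ : ℝ) (T : EReal) : Set ℝ := {t | t₀ ≤ t ∧ (t : EReal) < T}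

end MatrixLie

end

/-! The Leibniz rule of the error field `g` makes `h(s) = exp(s x)⁻¹ g(exp(s x))` a cocycle for
conjugation by the one-parameter group of `x`: `h(r + s) = exp(-s x) h(r) exp(s x) + h(s)`. Hence
its derivative at `s` is the conjugate `exp(-s x) v exp(s x)` of its derivative `v` at `0`, and
`h(1)` is the average of these conjugates over `[0, 1]`. The left-trivialized differential of `exp`
along the same ray is a cocycle of the same kind, and expanding the average in powers of `ad` gives
`dexp(-x) v`. For the error field `v = A x`, where `A` is its linearization at the identity, so
`exp(x)⁻¹ g(exp x) = dexp(-x) A x`: in exponential coordinates the error field is exactly the linear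
field `x ↦ A x`, and a velocity `exp(x) a` becomes `dexp(-x)⁻¹ a`. The curve `ξ` is differentiable
because it is a continuous lift through a map whose differential is injective. -/

namespace MatrixLie

section BanachAlgebra

open NormedSpace MeasureTheory

variable {A B : Type*} [NormedRing A] [NormedAlgebra ℝ A] [NormedRing B] [NormedAlgebra ℝ B]

/-- The average `∫₀¹ exp(-s x) v exp(s x) ds` of the conjugates of `v` along the one-parameter
group of `x`: the left-trivialized differential of `exp` at `x`, without reference to `ad`. -/
noncomputable def conjAverage (x v : A) : A :=
  ∫ s in (0 : ℝ)..1, exp (s • (-x)) * v * exp (s • x)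

theorem hasDerivAt_of_cocycle {h : ℝ → A} {x v : A} (h0 : HasDerivAt h v 0)
    (hh : ∀ r s, h (r + s) = exp (s • (-x)) * h r * exp (s • x) + h s) (s : ℝ) :
    HasDerivAt h (exp (s • (-x)) * v * exp (s • x)) s := by
  have h_shift : HasDerivAt (fun r => h (r - s)) v s :=
    HasDerivAt.comp_sub_const s s (by rwa [sub_self])
  refine (((h_shift.const_mul _).mul_const _).add_const (h s)).congr_of_eventuallyEq
    (.of_forall fun r => ?_)
  simpa using hh (r - s) s

variable [CompleteSpace A] [CompleteSpace B]

theorem exp_add_smul (r s : ℝ) (x : A) : exp ((r + s) • x) = exp (r • x) * exp (s • x) := by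
  let := NormedAlgebra.restrictScalars ℚ ℝ A
  rw [add_smul, exp_add_of_commute (((Commute.refl x).smul_left r).smul_right s)]

theorem exp_neg_mul_exp (x : A) : exp (-x) * exp x = 1 := by
  simpa using (exp_add_smul (-1) 1 x).symm

theorem exp_mul_exp_neg (x : A) : exp x * exp (-x) = 1 := by
  simpa using exp_neg_mul_exp (-x)

theorem continuous_exp_smul (x : A) : Continuous fun s : ℝ => exp (s • x) :=
  Differentiable.continuous (𝕜 := ℝ) (by fun_prop)

theorem eq_conjAverage_of_cocycle {h : ℝ → A} {x v : A} (h0 : HasDerivAt h v 0)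
    (hh : ∀ r s, h (r + s) = exp (s • (-x)) * h r * exp (s • x) + h s) :
    h 1 = conjAverage x v := by
  have h_zero : h 0 = 0 := by simpa using hh 0 0
  have h_cont : Continuous fun s : ℝ => exp (s • (-x)) * v * exp (s • x) :=
    ((continuous_exp_smul (-x)).mul continuous_const).mul (continuous_exp_smul x)
  rw [conjAverage, intervalIntegral.integral_eq_sub_of_hasDerivAt
    (fun s _ => hasDerivAt_of_cocycle h0 hh s) (h_cont.intervalIntegrable _ _), h_zero, sub_zero]

theorem fderiv_exp_add_smul (r s : ℝ) (x v : A) :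
    fderiv ℝ exp ((r + s) • x) ((r + s) • v) =
      fderiv ℝ exp (r • x) (r • v) * exp (s • x) +
        exp (r • x) * fderiv ℝ exp (s • x) (s • v) := by
  have hd (a : ℝ) : HasFDerivAt (fun y : A => exp (a • y))
      ((fderiv ℝ exp (a • x)).comp (a • ContinuousLinearMap.id ℝ A)) x :=
    (exp_analytic (𝕂 := ℝ) (a • x)).differentiableAt.hasFDerivAt.comp x
      ((hasFDerivAt_id x).fun_const_smul a)
  have hmul := ((hd r).mul' (hd s)).congr_of_eventuallyEq (.of_forall (exp_add_smul r s))
  have huniq := DFunLike.congr_fun ((hd (r + s)).unique hmul) v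
  simpa [add_comm] using huniq

theorem hasDerivAt_exp_neg_mul_fderiv_exp (x v : A) :
    HasDerivAt (fun s : ℝ => exp (s • (-x)) * fderiv ℝ exp (s • x) (s • v)) v 0 := by
  have hdiff : DifferentiableAt ℝ (fun s : ℝ => exp (s • (-x)) * fderiv ℝ exp (s • x) v) 0 := by
    have hfderiv : DifferentiableAt ℝ (fderiv ℝ (exp : A → A)) ((0 : ℝ) • x) :=
      (exp_analytic (𝕂 := ℝ) _).fderiv.differentiableAt
    have hline : DifferentiableAt ℝ (fun s : ℝ => s • x) 0 := by fun_prop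
    exact (differentiableAt_exp_smul_const (-x) 0).mul
      ((hfderiv.comp (0 : ℝ) hline).clm_apply (differentiableAt_const v))
  have hfderiv_zero : fderiv ℝ (exp : A → A) 0 = 1 := hasFDerivAt_exp_zero.fderiv
  refine (((hasDerivAt_id (0 : ℝ)).fun_smul hdiff.hasDerivAt).congr_deriv ?_).congr_of_eventuallyEq
    (.of_forall fun s => ?_)
  · simp [hfderiv_zero]
  · simp

theorem fderiv_exp_apply (x v : A) : fderiv ℝ exp x v = exp x * conjAverage x v := by
  -- By the product rule for `exp (r x) exp (s x)`, the left-trivialized differential is a cocycle.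
  have hcocycle (r s : ℝ) :
      exp ((r + s) • (-x)) * fderiv ℝ exp ((r + s) • x) ((r + s) • v) =
        exp (s • (-x)) * (exp (r • (-x)) * fderiv ℝ exp (r • x) (r • v)) * exp (s • x) +
          exp (s • (-x)) * fderiv ℝ exp (s • x) (s • v) := by
    have hcancel (y : A) : exp (r • (-x)) * (exp (r • x) * y) = y := by
      rw [← mul_assoc, smul_neg, exp_neg_mul_exp, one_mul]
    rw [fderiv_exp_add_smul, add_comm r s, exp_add_smul s r]
    simp only [mul_add, mul_assoc, hcancel]
  have h_one := eq_conjAverage_of_cocycle (hasDerivAt_exp_neg_mul_fderiv_exp x v) hcocycle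
  simp only [one_smul] at h_one
  rw [← h_one, ← mul_assoc, exp_mul_exp_neg, one_mul]

theorem integral_exp_smul_eq_tsum (b : B) :
    ∫ s in (0 : ℝ)..1, exp (s • b) = ∑' i : ℕ, ((i + 1).factorial : ℝ)⁻¹ • b ^ i := by
  have hterm (i : ℕ) : ∫ s in (0 : ℝ)..1, (i.factorial : ℝ)⁻¹ • (s • b) ^ i =
      ((i + 1).factorial : ℝ)⁻¹ • b ^ i := by
    simp only [smul_pow, smul_smul, intervalIntegral.integral_smul_const,
      intervalIntegral.integral_const_mul, integral_pow]
    congr 1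
    rw [Nat.factorial_succ]
    push_cast
    simp
  have hbound (i : ℕ) (s : ℝ) (hs : s ∈ Set.uIoc 0 1) :
      ‖(i.factorial : ℝ)⁻¹ • (s • b) ^ i‖ ≤ ‖(i.factorial : ℝ)⁻¹ • b ^ i‖ := by
    rw [Set.uIoc_of_le zero_le_one] at hs
    rw [smul_pow, smul_comm, norm_smul, norm_pow, Real.norm_of_nonneg hs.1.le]
    exact mul_le_of_le_one_left (norm_nonneg _) (pow_le_one₀ hs.1.le hs.2)
  have hsum := intervalIntegral.hasSum_integral_of_dominated_convergence (a := 0) (b := 1)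
    (μ := volume) (F := fun (i : ℕ) (s : ℝ) => (i.factorial : ℝ)⁻¹ • (s • b) ^ i)
    (fun i _ => ‖(i.factorial : ℝ)⁻¹ • b ^ i‖)
    (fun i => Continuous.aestronglyMeasurable (by fun_prop))
    (fun i => .of_forall (hbound i))
    (.of_forall fun s _ => norm_expSeries_summable' (𝕂 := ℝ) b)
    (by simp)
    (.of_forall fun s _ => exp_series_hasSum_exp' (𝕂 := ℝ) (s • b))
  rw [← hsum.tsum_eq]
  exact tsum_congr hterm

theorem map_exp_smul_of_intertwines (H : B →L[ℝ] A) {b : B} {x : A}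
    (hH : ∀ p, H (b * p) = H p * x - x * H p) (s : ℝ) :
    H (exp (s • b)) = exp (s • (-x)) * H 1 * exp (s • x) := by
  have hd (s : ℝ) :
      HasDerivAt (fun s : ℝ => exp (s • x) * H (exp (s • b)) * exp (s • (-x))) 0 s := by
    refine (((hasDerivAt_exp_smul_const (𝕂 := ℝ) x s).fun_mul
      (H.hasFDerivAt.comp_hasDerivAt s (hasDerivAt_exp_smul_const' (𝕂 := ℝ) b s))).fun_mul
      (hasDerivAt_exp_smul_const' (𝕂 := ℝ) (-x) s)).congr_deriv ?_
    simp only [Function.comp_apply, hH]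
    noncomm_ring
  have hconst : exp (s • x) * H (exp (s • b)) * exp (s • (-x)) = H 1 := by
    simpa using is_const_of_deriv_eq_zero (fun s => (hd s).differentiableAt)
      (fun s => (hd s).deriv) s 0
  have hinv : exp (s • (-x)) * exp (s • x) = 1 := by rw [smul_neg, exp_neg_mul_exp]
  rw [← hconst]
  simp only [mul_assoc]
  rw [hinv, mul_one, ← mul_assoc, hinv, one_mul]

theorem map_tsum_pow_of_intertwines (H : B →L[ℝ] A) {b : B} {x : A}
    (hH : ∀ p, H (b * p) = H p * x - x * H p) :
    H (∑' i : ℕ, ((i + 1).factorial : ℝ)⁻¹ • b ^ i) = conjAverage x (H 1) := by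
  rw [← integral_exp_smul_eq_tsum,
    ← H.intervalIntegral_comp_comm ((continuous_exp_smul b).intervalIntegrable _ _)]
  simp only [map_exp_smul_of_intertwines H hH, conjAverage]

end BanachAlgebra

section Lift

open Filter Asymptotics

theorem hasDerivWithinAt_of_comp {𝕜 E F : Type*} [NontriviallyNormedField 𝕜]
    [NormedAddCommGroup E] [NormedSpace 𝕜 E] [NormedAddCommGroup F] [NormedSpace 𝕜 F]
    {φ : E → F} {L : E →L[𝕜] F} {K : NNReal} {ξ : 𝕜 → E} {S : Set 𝕜} {t : 𝕜} {v : E}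
    (hφ : HasFDerivAt φ L (ξ t)) (hL : AntilipschitzWith K L)
    (hξ : ContinuousWithinAt ξ S t) (hd : HasDerivWithinAt (φ ∘ ξ) (L v) S t) :
    HasDerivWithinAt ξ v S t := by
  have hL_bound (g : 𝕜 → E) : g =O[𝓝[S] t] fun s => L (g s) :=
    .of_bound K (.of_forall fun s => hL.le_mul_norm (map_zero L) (g s))
  have hφξ : (fun s => φ (ξ s) - φ (ξ t) - L (ξ s - ξ t)) =o[𝓝[S] t] fun s => ξ s - ξ t :=
    (hasFDerivAt_iff_isLittleO.1 hφ).comp_tendsto hξ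
  have hφξ_bound : (fun s => φ (ξ s) - φ (ξ t)) =O[𝓝[S] t] fun s => s - t :=
    hd.hasFDerivWithinAt.isBigO_sub
  have hξ_bound : (fun s => ξ s - ξ t) =O[𝓝[S] t] fun s => s - t := by
    have := (hφξ.trans_isBigO (hL_bound _)).right_isBigO_add
    simp only [sub_add_cancel] at this
    exact (hL_bound _).trans (this.trans hφξ_bound)
  rw [hasDerivWithinAt_iff_isLittleO] at hd ⊢
  refine (hL_bound _).trans_isLittleO
    ((hd.sub (hφξ.trans_isBigO hξ_bound)).congr_left fun s => ?_)
  simp only [Function.comp_apply, map_sub, map_smul]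
  abel

end Lift

theorem differentiableAt_clm_comp_iff {𝕜 E F H : Type*} [NontriviallyNormedField 𝕜]
    [CompleteSpace 𝕜] [NormedAddCommGroup E] [NormedSpace 𝕜 E] [NormedAddCommGroup F]
    [NormedSpace 𝕜 F] [NormedAddCommGroup H] [NormedSpace 𝕜 H] [FiniteDimensional 𝕜 H]
    {L : F →L[𝕜] H} (hL : Function.Injective L) {g : E → F} {x : E} :
    DifferentiableAt 𝕜 (fun y => L (g y)) x ↔ DifferentiableAt 𝕜 g x := by
  refine ⟨fun h => ?_, fun h => L.differentiableAt.comp x h⟩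
  obtain ⟨P, hP⟩ := L.toLinearMap.exists_leftInverse_of_injective (LinearMap.ker_eq_bot.2 hL)
  have hPL (y : E) : P (L (g y)) = g y := LinearMap.congr_fun hP (g y)
  simpa [Function.comp_def, hPL] using P.toContinuousLinearMap.differentiableAt.comp x h

section MatrixGroup

open scoped Matrix.Norms.Operator

variable {n : ℕ} {G : ClosedSubgroup (GL (Fin n) ℝ)}

theorem mat_mul (X Y : G) : mat (X * Y) = mat X * mat Y := rfl

theorem mat_one : mat (1 : G) = 1 := rfl

theorem mat_mul_inv (X : G) : mat X * mat X⁻¹ = 1 := by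
  rw [← mat_mul, mul_inv_cancel, mat_one]

theorem mat_inv_mul (X : G) : mat X⁻¹ * mat X = 1 := by
  rw [← mat_mul, inv_mul_cancel, mat_one]

theorem mat_mul_inv_cancel_left (X : G) (M : Matrix (Fin n) (Fin n) ℝ) :
    mat X * (mat X⁻¹ * M) = M := by
  rw [← mul_assoc, mat_mul_inv, one_mul]

theorem mat_inv_mul_cancel_left (X : G) (M : Matrix (Fin n) (Fin n) ℝ) :
    mat X⁻¹ * (mat X * M) = M := by
  rw [← mul_assoc, mat_inv_mul, one_mul]

theorem mat_injective : Function.Injective (mat : G → Matrix (Fin n) (Fin n) ℝ) :=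
  fun _ _ h => Subtype.ext (Units.ext h)

theorem isInducing_mat : Topology.IsInducing (mat : G → Matrix (Fin n) (Fin n) ℝ) :=
  (Units.isOpenEmbedding_val (R := Matrix (Fin n) (Fin n) ℝ)).isInducing.comp
    Topology.IsInducing.subtypeVal

theorem hasDerivWithinAt_mat_inv {X : ℝ → G} {X' : Matrix (Fin n) (Fin n) ℝ} {S : Set ℝ} {t : ℝ}
    (hX : HasDerivWithinAt (fun s => mat (X s)) X' S t) :
    HasDerivWithinAt (fun s => mat (X s)⁻¹) (-(mat (X t)⁻¹ * X' * mat (X t)⁻¹)) S t := by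
  have hinverse (Y : G) : Ring.inverse (mat Y) = mat Y⁻¹ := Ring.inverse_unit (Y : GL (Fin n) ℝ)
  have h := (hasFDerivAt_ringInverse (𝕜 := ℝ) (X t : GL (Fin n) ℝ)).comp_hasDerivWithinAt t hX
  exact h.congr (fun s _ => (hinverse (X s)).symm) (hinverse (X t)).symm

end MatrixGroup

section Coordinates

open NormedSpace

open scoped Matrix.Norms.Operator

variable {n d : ℕ} {G : ClosedSubgroup (GL (Fin n) ℝ)}

/-- The identification `hat` of `ℝᵈ` with `𝔤`, as a continuous linear map into the normed space of
all matrices, where curves in `G` are differentiated. -/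
noncomputable def hatL (hat : (Fin d → ℝ) ≃ₗ[ℝ] lieAlgebra G) :
    (Fin d → ℝ) →L[ℝ] Matrix (Fin n) (Fin n) ℝ :=
  LinearMap.toContinuousLinearMap ((lieAlgebra G).subtype ∘ₗ hat.toLinearMap)

variable (hat : (Fin d → ℝ) ≃ₗ[ℝ] lieAlgebra G)

theorem hatL_apply (x : Fin d → ℝ) : hatL hat x = (hat x : Matrix (Fin n) (Fin n) ℝ) := rfl

theorem hatL_injective : Function.Injective (hatL hat) :=
  Subtype.val_injective.comp hat.injective

theorem hatL_vee {M : Matrix (Fin n) (Fin n) ℝ} (hM : M ∈ lieAlgebra G) :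
    hatL hat (vee hat M) = M := by
  simp [vee, hM, hatL_apply]

theorem hatL_Adm (X : G) (w : Fin d → ℝ) :
    hatL hat (Adm hat X w) = mat X * hatL hat w * mat X⁻¹ := by
  rw [hatL_apply, Adm, hat.apply_symm_apply]
  rfl

theorem mat_expm (x : Fin d → ℝ) : mat (expm hat x) = exp (hatL hat x) := rfl

theorem expm_add_smul (r s : ℝ) (x : Fin d → ℝ) :
    expm hat ((r + s) • x) = expm hat (r • x) * expm hat (s • x) := by
  refine mat_injective ?_
  simp only [mat_mul, mat_expm, map_smul]
  exact exp_add_smul r s (hatL hat x)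

theorem inv_expm (x : Fin d → ℝ) : (expm hat x)⁻¹ = expm hat (-x) := by
  refine inv_eq_of_mul_eq_one_left (mat_injective ?_)
  rw [mat_mul, mat_expm, mat_expm, map_neg]
  exact exp_neg_mul_exp (hatL hat x)

theorem hatL_dexpm_neg_mulVec (x v : Fin d → ℝ) :
    hatL hat (dexpm hat (-x) *ᵥ v) = conjAverage (hatL hat x) (hatL hat v) := by
  let evalHat : Matrix (Fin d) (Fin d) ℝ →L[ℝ] Matrix (Fin n) (Fin n) ℝ :=
    LinearMap.toContinuousLinearMap
      ((hatL hat).toLinearMap ∘ₗ LinearMap.applyₗ v ∘ₗ (Matrix.toLin' (R := ℝ)).toLinearMap)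
  have evalHat_apply (p : Matrix (Fin d) (Fin d) ℝ) : evalHat p = hatL hat (p *ᵥ v) := rfl
  have hintertwines (p : Matrix (Fin d) (Fin d) ℝ) :
      evalHat (adm hat (-x) * p) = evalHat p * hatL hat x - hatL hat x * evalHat p := by
    rw [evalHat_apply, evalHat_apply, ← Matrix.mulVec_mulVec, adm, LinearMap.toMatrix'_mulVec]
    simp only [hatL_apply, ad, LinearMap.coe_comp, LinearEquiv.coe_coe, Function.comp_apply,
      LinearMap.coe_mk, AddHom.coe_mk, LinearEquiv.apply_symm_apply, map_neg, NegMemClass.coe_neg]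
    noncomm_ring
  have evalHat_one : evalHat 1 = hatL hat v := congrArg (hatL hat) (Matrix.one_mulVec v)
  exact (map_tsum_pow_of_intertwines evalHat hintertwines).trans (congrArg _ evalHat_one)

theorem differentiable_mat_expm : Differentiable ℝ fun x => mat (expm hat x) := fun x =>
  (exp_analytic (𝕂 := ℝ) (hatL hat x)).differentiableAt.comp x (hatL hat).differentiableAt

theorem differentiable_mat_inv_expm : Differentiable ℝ fun x => mat (expm hat x)⁻¹ := by
  simp only [inv_expm]
  exact (differentiable_mat_expm hat).comp
    (by fun_prop : Differentiable ℝ fun x : Fin d → ℝ => -x)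

theorem fderiv_mat_expm_apply (x v : Fin d → ℝ) :
    fderiv ℝ (fun y => mat (expm hat y)) x v =
      mat (expm hat x) * hatL hat (dexpm hat (-x) *ᵥ v) := by
  have hcomp := (exp_analytic (𝕂 := ℝ) (hatL hat x)).differentiableAt.hasFDerivAt.comp x
    (hatL hat).hasFDerivAt
  rw [hatL_dexpm_neg_mulVec, mat_expm]
  exact (DFunLike.congr_fun hcomp.fderiv v).trans (fderiv_exp_apply (hatL hat x) (hatL hat v))

theorem fderiv_mat_expm_injective {x : Fin d → ℝ} (hx : IsUnit (dexpm hat (-x))) :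
    Function.Injective (fderiv ℝ (fun y => mat (expm hat y)) x) := fun v y hvy => by
  rw [fderiv_mat_expm_apply, fderiv_mat_expm_apply] at hvy
  have hmulVec := congrArg (mat (expm hat x)⁻¹ * ·) hvy
  simp only [mat_inv_mul_cancel_left] at hmulVec
  exact Matrix.mulVec_injective_of_isUnit hx (hatL_injective hat hmulVec)

variable {hat} {F g : G → Matrix (Fin n) (Fin n) ℝ}

theorem hatL_pullback (hF : IsVectorField F) (x : Fin d → ℝ) :
    hatL hat (pullback hat F x) = mat (expm hat x)⁻¹ * F (expm hat x) :=
  hatL_vee hat (hF _)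

theorem differentiableAt_pullback_iff (hF : IsVectorField F) {x : Fin d → ℝ} :
    DifferentiableAt ℝ (pullback hat F) x ↔
      DifferentiableAt ℝ (fun y => mat (expm hat y)⁻¹ * F (expm hat y)) x := by
  simp only [← hatL_pullback hF]
  exact (differentiableAt_clm_comp_iff (hatL_injective hat)).symm

/-- The Leibniz rule `g (X Y) = g X Y + X g Y`, which is the form the affine property takes for the
two error fields. Equivalently, `X ↦ X⁻¹ g X` is a crossed homomorphism. -/
def IsDerivationField (g : G → Matrix (Fin n) (Fin n) ℝ) : Prop :=
  ∀ X Y : G, g (X * Y) = g X * mat Y + mat X * g Y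

theorem IsDerivationField.mat_inv_mul_apply_mul (hg : IsDerivationField g) (X Y : G) :
    mat (X * Y)⁻¹ * g (X * Y) = mat Y⁻¹ * (mat X⁻¹ * g X) * mat Y + mat Y⁻¹ * g Y := by
  rw [hg, mul_inv_rev, mat_mul]
  simp only [mul_add, mul_assoc, mat_inv_mul_cancel_left]

theorem IsDerivationField.hatL_pullback (hg : IsDerivationField g) (hv : IsVectorField g)
    (hd : DifferentiableAt ℝ (pullback hat g) 0) (x : Fin d → ℝ) :
    hatL hat (pullback hat g x) = hatL hat (dexpm hat (-x) *ᵥ linearization hat g x) := by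
  have hderiv : HasDerivAt (fun s : ℝ => hatL hat (pullback hat g (s • x)))
      (hatL hat (linearization hat g x)) 0 := by
    have hline : HasDerivAt (fun s : ℝ => s • x) x 0 := by
      simpa using (hasDerivAt_id (0 : ℝ)).smul_const x
    have hpullback : HasFDerivAt (pullback hat g) (linearization hat g) ((0 : ℝ) • x) := by
      rw [zero_smul]
      exact hd.hasFDerivAt
    have hray : HasDerivAt (fun s : ℝ => pullback hat g (s • x)) (linearization hat g x) 0 :=
      HasFDerivAt.comp_hasDerivAt (l := pullback hat g) 0 hpullback hline
    exact (hatL hat).hasFDerivAt.comp_hasDerivAt 0 hray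
  have hcocycle (r s : ℝ) : hatL hat (pullback hat g ((r + s) • x)) =
      exp (s • (-hatL hat x)) * hatL hat (pullback hat g (r • x)) * exp (s • hatL hat x) +
        hatL hat (pullback hat g (s • x)) := by
    have hinv : exp (s • (-hatL hat x)) = mat (expm hat (s • x))⁻¹ := by
      rw [inv_expm, mat_expm, ← smul_neg, map_smul, map_neg]
    simp only [MatrixLie.hatL_pullback hv, expm_add_smul, hg.mat_inv_mul_apply_mul, hinv,
      ← map_smul, ← mat_expm]
  rw [hatL_dexpm_neg_mulVec, ← eq_conjAverage_of_cocycle hderiv hcocycle, one_smul]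

theorem IsDerivationField.fderiv_mat_expm_linearization (hg : IsDerivationField g)
    (hv : IsVectorField g) (hd : DifferentiableAt ℝ (pullback hat g) 0) (x : Fin d → ℝ) :
    fderiv ℝ (fun y => mat (expm hat y)) x (linearization hat g x) = g (expm hat x) := by
  rw [fderiv_mat_expm_apply, ← hg.hatL_pullback hv hd, MatrixLie.hatL_pullback hv,
    mat_mul_inv_cancel_left]

theorem IsDerivationField.hasDerivWithinAt_log (hg : IsDerivationField g) (hv : IsVectorField g)
    (hd : DifferentiableAt ℝ (pullback hat g) 0) {D : Set G} {log : G → Fin d → ℝ}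
    (hlog : ContinuousOn log D) (hexp : ∀ X ∈ D, expm hat (log X) = X) {S : Set ℝ} {η : ℝ → G}
    (hηD : ∀ s ∈ S, η s ∈ D) {ξ : ℝ → Fin d → ℝ} (hξ : ∀ s ∈ S, ξ s = log (η s)) {t : ℝ}
    (ht : t ∈ S) (hu : IsUnit (dexpm hat (-ξ t))) {a : Fin d → ℝ}
    (hη : HasDerivWithinAt (fun s => mat (η s)) (g (η t) + mat (η t) * hatL hat a) S t) :
    HasDerivWithinAt ξ ((dexpm hat (-ξ t))⁻¹ *ᵥ a + linearization hat g (ξ t)) S t := by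
  have hexp_ξ (s : ℝ) (hs : s ∈ S) : expm hat (ξ s) = η s := by rw [hξ s hs, hexp _ (hηD s hs)]
  have hξ_cont : ContinuousWithinAt ξ S t :=
    ((hlog (η t) (hηD t ht)).comp
      (isInducing_mat.continuousWithinAt_iff.2 hη.continuousWithinAt) hηD).congr hξ (hξ t ht)
  have hdexpm : dexpm hat (-ξ t) *ᵥ ((dexpm hat (-ξ t))⁻¹ *ᵥ a) = a := by
    rw [Matrix.mulVec_mulVec, Matrix.mul_nonsing_inv _ ((Matrix.isUnit_iff_isUnit_det _).1 hu),
      Matrix.one_mulVec]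
  have hvelocity : fderiv ℝ (fun y => mat (expm hat y)) (ξ t)
      ((dexpm hat (-ξ t))⁻¹ *ᵥ a + linearization hat g (ξ t)) =
        g (η t) + mat (η t) * hatL hat a := by
    rw [map_add, hg.fderiv_mat_expm_linearization hv hd, fderiv_mat_expm_apply, hdexpm,
      hexp_ξ t ht, add_comm]
  obtain ⟨K, -, hK⟩ :=
    (LinearMap.injective_iff_antilipschitz _).1 (fderiv_mat_expm_injective hat hu)
  have hη_expm := hη.congr (fun s hs => congrArg mat (hexp_ξ s hs)) (congrArg mat (hexp_ξ t ht))
  exact hasDerivWithinAt_of_comp (differentiable_mat_expm hat (ξ t)).hasFDerivAt hK hξ_cont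
    (hη_expm.congr_deriv hvelocity.symm)

theorem IsGroupAffine.isDerivationField_leftErrorField (hF : IsGroupAffine F) :
    IsDerivationField (leftErrorField F) := fun X Y => by
  simp only [leftErrorField, hF X Y, mat_mul]
  noncomm_ring

theorem IsGroupAffine.isDerivationField_rightErrorField (hF : IsGroupAffine F) :
    IsDerivationField (rightErrorField F) := fun X Y => by
  simp only [rightErrorField, hF X Y, mat_mul]
  noncomm_ring

theorem IsVectorField.apply_one_mem (hF : IsVectorField F) : F 1 ∈ lieAlgebra G := by
  simpa only [inv_one, mat_one, one_mul] using hF 1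

theorem IsVectorField.isVectorField_leftErrorField (hF : IsVectorField F) :
    IsVectorField (leftErrorField F) := fun X => by
  have hconj : mat X⁻¹ * F 1 * mat X ∈ lieAlgebra G := by
    simpa only [Ad, inv_inv] using (Ad X⁻¹ ⟨F 1, hF.apply_one_mem⟩).2
  rw [leftErrorField, mul_sub, ← mul_assoc]
  exact (lieAlgebra G).sub_mem (hF X) hconj

theorem IsVectorField.isVectorField_rightErrorField (hF : IsVectorField F) :
    IsVectorField (rightErrorField F) := fun X => by
  rw [rightErrorField, mul_sub, mat_inv_mul_cancel_left]
  exact (lieAlgebra G).sub_mem (hF X) hF.apply_one_mem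

theorem IsVectorField.differentiableAt_pullback_leftErrorField (hF : IsVectorField F)
    {x : Fin d → ℝ} (hd : DifferentiableAt ℝ (pullback hat F) x) :
    DifferentiableAt ℝ (pullback hat (leftErrorField F)) x := by
  rw [differentiableAt_pullback_iff hF] at hd
  rw [differentiableAt_pullback_iff hF.isVectorField_leftErrorField]
  simp only [leftErrorField, mul_sub]
  exact hd.sub ((differentiable_mat_inv_expm hat x).mul
    ((differentiable_mat_expm hat x).const_mul (F 1)))

theorem IsVectorField.differentiableAt_pullback_rightErrorField (hF : IsVectorField F)
    {x : Fin d → ℝ} (hd : DifferentiableAt ℝ (pullback hat F) x) :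
    DifferentiableAt ℝ (pullback hat (rightErrorField F)) x := by
  rw [differentiableAt_pullback_iff hF] at hd
  rw [differentiableAt_pullback_iff hF.isVectorField_rightErrorField]
  simp only [rightErrorField, mul_sub, mat_inv_mul_cancel_left]
  exact hd.sub_const _

theorem IsGroupAffine.hasDerivWithinAt_leftError (hF : IsGroupAffine F) {X Xhat : ℝ → G}
    {S : Set ℝ} {t : ℝ} {W : Matrix (Fin n) (Fin n) ℝ}
    (hX : HasDerivWithinAt (fun s => mat (X s)) (F (X t) + mat (X t) * W) S t)
    (hXhat : HasDerivWithinAt (fun s => mat (Xhat s)) (F (Xhat t)) S t) :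
    HasDerivWithinAt (fun s => mat (leftError X Xhat s))
      (leftErrorField F (leftError X Xhat t) + mat (leftError X Xhat t) * W) S t := by
  refine ((hasDerivWithinAt_mat_inv hXhat).mul hX).congr_deriv ?_
  have hX_eq : X t = Xhat t * leftError X Xhat t := by rw [leftError, mul_inv_cancel_left]
  rw [leftErrorField, hX_eq, hF]
  simp only [mat_mul, mul_add, mul_sub, neg_mul, mul_assoc, mat_inv_mul_cancel_left]
  abel

theorem IsGroupAffine.hasDerivWithinAt_rightError (hF : IsGroupAffine F) {X Xhat : ℝ → G}
    {S : Set ℝ} {t : ℝ} {W : Matrix (Fin n) (Fin n) ℝ}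
    (hX : HasDerivWithinAt (fun s => mat (X s)) (F (X t) + mat (X t) * W) S t)
    (hXhat : HasDerivWithinAt (fun s => mat (Xhat s)) (F (Xhat t)) S t) :
    HasDerivWithinAt (fun s => mat (rightError X Xhat s))
      (rightErrorField F (rightError X Xhat t) +
        mat (rightError X Xhat t) * (mat (Xhat t) * W * mat (Xhat t)⁻¹)) S t := by
  refine (hX.mul (hasDerivWithinAt_mat_inv hXhat)).congr_deriv ?_
  have hX_eq : X t = rightError X Xhat t * Xhat t := by rw [rightError, inv_mul_cancel_right]
  rw [rightErrorField, hX_eq, hF]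
  simp only [mat_mul, add_mul, sub_mul, mul_neg, mul_assoc, mat_mul_inv, mul_one,
    mat_mul_inv_cancel_left]
  abel

end Coordinates

end MatrixLie

open MatrixLie in
theorem theorem2_general {n d : ℕ} {G : ClosedSubgroup (GL (Fin n) ℝ)}
    {hat : (Fin d → ℝ) ≃ₗ[ℝ] lieAlgebra G} {F : G → Matrix (Fin n) (Fin n) ℝ}
    (hF_tangent : IsVectorField F) (hF_affine : IsGroupAffine F)
    (hF_diff : DifferentiableAt ℝ (pullback hat F) 0)
    {S : Set ℝ} {t : ℝ} (ht : t ∈ S) {w : Fin d → ℝ} {X Xhat : ℝ → G}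
    (hX : HasDerivWithinAt (fun s => mat (X s))
      (F (X t) + mat (X t) * (hat w : Matrix (Fin n) (Fin n) ℝ)) S t)
    (hXhat : HasDerivWithinAt (fun s => mat (Xhat s)) (F (Xhat t)) S t)
    {D : Set G} {log : G → Fin d → ℝ} (hlog : ContinuousOn log D)
    (hexp : ∀ Y ∈ D, expm hat (log Y) = Y) {ξ : ℝ → Fin d → ℝ}
    (hu : IsUnit (dexpm hat (-ξ t))) :
    ((∀ s ∈ S, leftError X Xhat s ∈ D) → (∀ s ∈ S, ξ s = log (leftError X Xhat s)) →
      HasDerivWithinAt ξ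
        ((dexpm hat (-ξ t))⁻¹ *ᵥ w + linearization hat (leftErrorField F) (ξ t)) S t) ∧
    ((∀ s ∈ S, rightError X Xhat s ∈ D) → (∀ s ∈ S, ξ s = log (rightError X Xhat s)) →
      HasDerivWithinAt ξ
        ((dexpm hat (-ξ t))⁻¹ *ᵥ Adm hat (Xhat t) w +
          linearization hat (rightErrorField F) (ξ t)) S t) := by
  refine ⟨fun hD hξ => ?_, fun hD hξ => ?_⟩
  · exact hF_affine.isDerivationField_leftErrorField.hasDerivWithinAt_log
      hF_tangent.isVectorField_leftErrorField
      (hF_tangent.differentiableAt_pullback_leftErrorField hF_diff) hlog hexp hD hξ ht hu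
      (hF_affine.hasDerivWithinAt_leftError hX hXhat)
  · refine hF_affine.isDerivationField_rightErrorField.hasDerivWithinAt_log
      hF_tangent.isVectorField_rightErrorField
      (hF_tangent.differentiableAt_pullback_rightErrorField hF_diff) hlog hexp hD hξ ht hu ?_
    rw [hatL_Adm]
    exact hF_affine.hasDerivWithinAt_rightError hX hXhat

open MatrixLie in
theorem theorem2 {n d : ℕ} {G : ClosedSubgroup (GL (Fin n) ℝ)}
    (hat : (Fin d → ℝ) ≃ₗ[ℝ] lieAlgebra G)
    {U : Type*} (f : U → G → Matrix (Fin n) (Fin n) ℝ)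
    (hf_tangent : ∀ a, IsVectorField (f a))
    (hf_affine : ∀ a, IsGroupAffine (f a))
    (hf_diff : ∀ a, DifferentiableAt ℝ (pullback hat (f a)) 0)
    (t₀ : ℝ) (T : EReal) (hT : (t₀ : EReal) < T)
    (u : ℝ → U) (w : ℝ → Fin d → ℝ)
    (hw : ContDiffOn ℝ ∞ w (timeInterval t₀ T))
    (X Xhat : ℝ → G)
    (hX : ∀ t ∈ timeInterval t₀ T, HasDerivWithinAt (fun s => mat (X s))
      (f (u t) (X t) + mat (X t) * (hat (w t) : Matrix (Fin n) (Fin n) ℝ)) (timeInterval t₀ T) t)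
    (hXhat : ∀ t ∈ timeInterval t₀ T, HasDerivWithinAt (fun s => mat (Xhat s))
      (f (u t) (Xhat t)) (timeInterval t₀ T) t)
    (D : Set G) (log : G → Fin d → ℝ) (hlog : IsLieLog hat D log) :
    ((∀ t ∈ timeInterval t₀ T, leftError X Xhat t ∈ D) →
      ∀ ξ : ℝ → Fin d → ℝ, (∀ t ∈ timeInterval t₀ T, ξ t = log (leftError X Xhat t)) →
      (∀ t ∈ timeInterval t₀ T, IsUnit (dexpm hat (-ξ t))) →
      ∀ t ∈ timeInterval t₀ T, HasDerivWithinAt ξ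
        ((dexpm hat (-ξ t))⁻¹ *ᵥ w t + linearization hat (leftErrorField (f (u t))) (ξ t))
        (timeInterval t₀ T) t) ∧
    ((∀ t ∈ timeInterval t₀ T, rightError X Xhat t ∈ D) →
      ∀ ξ : ℝ → Fin d → ℝ, (∀ t ∈ timeInterval t₀ T, ξ t = log (rightError X Xhat t)) →
      (∀ t ∈ timeInterval t₀ T, IsUnit (dexpm hat (-ξ t))) →
      ∀ t ∈ timeInterval t₀ T, HasDerivWithinAt ξ
        ((dexpm hat (-ξ t))⁻¹ *ᵥ Adm hat (Xhat t) (w t) +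
          linearization hat (rightErrorField (f (u t))) (ξ t))
        (timeInterval t₀ T) t) := by
  have at_time (ξ : ℝ → Fin d → ℝ) (t : ℝ) (ht : t ∈ timeInterval t₀ T) :=
    theorem2_general (ξ := ξ) (hf_tangent (u t)) (hf_affine (u t)) (hf_diff (u t)) ht (hX t ht)
      (hXhat t ht) hlog.continuousOn hlog.exp_log
  exact ⟨fun hD ξ hξ hu t ht => (at_time ξ t ht (hu t ht)).1 hD hξ,
    fun hD ξ hξ hu t ht => (at_time ξ t ht (hu t ht)).2 hD hξ⟩
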